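/- Let $X$ be a $\sigma$-compact, locally compact, locally connected Hausdorff space with only finitely many connected components (for example, a connected one). Call a subset of $X$ bounded if its closure is compact, and call a sequence in $X$ a simple end if it visits every bounded set only finitely many times. Two simple ends $(x_n)$ and $(y_n)$ are Freudenthal-equivalent if for every strictly increasing $a:\mathbb N\to\mathbb N$, every compact $K\subseteq X$ and every component $U$ of $X\setminus K$: if $x_{a(n)}\in U$ for all $n$, then $y_{a(n)}\in U$ for all but finitely many $n$; and if $y_{a(n)}\in U$ for all $n$, then $x_{a(n)}\in U$ for all but finitely many $n$. This is an equivalence relation on the set of simple ends, that is, a simple coarse structure. A function $f:X\to[0,1]$ is slowly oscillating if $|f(x_n)-f(y_n)|\to 0$ for any two Freudenthal-equivalent simple ends $(x_n)$ and $(y_n)$. A compactification of $X$ is a compact Hausdorff space containing $X$ as a dense subspace; its corona is the complement of $X$. A corona is zero-dimensional if its clopen subsets form a basis (the empty corona of a compact $X$ is allowed). A compactification $\bar X$ dominates $\hat X$ if the identity of $X$ extends to a continuous map $\bar X\to\hat X$. A Higson compactification of $X$ for the above structure is a compactification $\bar X$ such that a function $f:X\to[0,1]$ extends to a continuous function $\bar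 X\to[0,1]$ if and only if $f$ is continuous and slowly oscillating. **Theorem.** The Higson compactification $\bar X$ of $X$ for the simple coarse structure given by Freudenthal-equivalence exists, and it is the Freudenthal compactification of $X$: its corona $\bar X\setminus X$ is zero-dimensional, and $\bar X$ dominates every compactification of $X$ whose corona is zero-dimensional. -/

import Mathlib

open Set Filter Topology

/-- A bounded structure on a set `X`: a family of subsets, called bounded, that contains all
singletons, is closed under passing to subsets, and contains `A ∪ C` whenever it contains `A` and
`C` and these two sets meet. -/
structure BoundedStructure (X : Type*) where
  IsBounded : Set X → Prop
  singleton : ∀ x, IsBounded {x}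
  subset : ∀ A C, A ⊆ C → IsBounded C → IsBounded A
  union : ∀ A C, IsBounded A → IsBounded C → (A ∩ C).Nonempty → IsBounded (A ∪ C)

/-- A simple end: a sequence which visits every bounded set only finitely many times. -/
def SimpleEnd {X : Type*} (B : BoundedStructure X) : Type _ :=
  {x : ℕ → X // ∀ A, B.IsBounded A → {n | x n ∈ A}.Finite}

/-- A simple coarse structure: an equivalence relation on the set of simple ends. -/
abbrev SimpleCoarseStructure {X : Type*} (B : BoundedStructure X) : Type _ :=
  Setoid (SimpleEnd B)

namespace SimpleCoarseStructure

variable {X : Type*} {B : BoundedStructure X}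

/-- A function to a metric space is slowly oscillating if the distance between its values along
any two equivalent simple ends tends to `0`. -/
def SlowlyOscillating (S : SimpleCoarseStructure B) {Y : Type*} [MetricSpace Y] (f : X → Y) :
    Prop :=
  ∀ x y : SimpleEnd B, S.r x y → Tendsto (fun n => dist (f (x.1 n)) (f (y.1 n))) atTop (𝓝 0)

/-- Compatibility with the topology: the bounded sets are exactly the pre-compact sets. -/
def IsCompatible [TopologicalSpace X] (_S : SimpleCoarseStructure B) : Prop :=
  ∀ A : Set X, B.IsBounded A ↔ IsCompact (closure A)

end SimpleCoarseStructure

/-- `i : X → H` exhibits the compact Hausdorff space `H` as a compactification of `X`. -/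
structure IsCompactification {X H : Type*} [TopologicalSpace X] [TopologicalSpace H]
    (i : X → H) : Prop where
  compactSpace : CompactSpace H
  t2Space : T2Space H
  isDenseEmbedding : IsDenseEmbedding i

/-- The corona `H ∖ X` of a compactification `i : X → H`, with the subspace topology. -/
abbrev Corona {X H : Type*} (i : X → H) : Type _ := ↥((range i)ᶜ : Set H)

/-- The corona is zero-dimensional: its small inductive dimension is at most `0`, that is, its
clopen subsets form a basis. The empty corona (of a compact `X`) is allowed. -/
def HasZeroDimensionalCorona {X H : Type*} [TopologicalSpace H] (i : X → H) : Prop :=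
  HasSmallInductiveDimensionLE (Corona i) 0

/-- The compactification `i : X → H` dominates `j : X → Y`: the identity of `X` extends to a
continuous map `H → Y`. -/
def Dominates {X H Y : Type*} [TopologicalSpace H] [TopologicalSpace Y]
    (i : X → H) (j : X → Y) : Prop :=
  ∃ p : H → Y, Continuous p ∧ p ∘ i = j

/-- `i : X → H` is the Higson compactification of `X` for the simple coarse structure `S`: the
functions `X → [0, 1]` that extend continuously to `H` are exactly the continuous slowly
oscillating ones. -/
structure IsHigsonCompactification {X H : Type*} [TopologicalSpace X] [TopologicalSpace H]
    {B : BoundedStructure X} (S : SimpleCoarseStructure B) (i : X → H) : Prop where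
  compatible : S.IsCompatible
  isCompactification : IsCompactification i
  extends_iff : ∀ f : X → unitInterval,
    (∃ g : H → unitInterval, Continuous g ∧ g ∘ i = f) ↔ (Continuous f ∧ S.SlowlyOscillating f)

universe u v w

/-- `i : X → H` is the Freudenthal compactification of `X`: its corona is zero-dimensional, and it
dominates every compactification of `X` (in the universe `w`) whose corona is zero-dimensional. -/
structure IsFreudenthalCompactification {X : Type u} {H : Type v} [TopologicalSpace X]
    [TopologicalSpace H] (i : X → H) : Prop where
  isCompactification : IsCompactification i
  zeroDimensional : HasZeroDimensionalCorona i
  dominates : ∀ (Y : Type w) [TopologicalSpace Y] (j : X → Y),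
    IsCompactification j → HasZeroDimensionalCorona j → Dominates i j

/-- The bounded structure of pre-compact subsets of a Hausdorff space. -/
def precompactSets (X : Type*) [TopologicalSpace X] [T2Space X] : BoundedStructure X where
  IsBounded A := IsCompact (closure A)
  singleton x := by simp
  subset _ _ h hC := hC.of_isClosed_subset isClosed_closure (closure_mono h)
  union _ _ hA hC _ := by
    rw [closure_union]
    exact hA.union hC

/-- Freudenthal-equivalence of sequences: for every subsequence, every compact `K` and every
component `U` of `X ∖ K`, if one of the two subsequences lies in `U` then the other one lies in
`U` from some index on. -/
def FreudenthalEquivalent {X : Type*} [TopologicalSpace X] (x y : ℕ → X) : Prop :=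
  ∀ a : ℕ → ℕ, StrictMono a → ∀ K : Set X, IsCompact K → ∀ p ∈ Kᶜ,
    ((∀ n, x (a n) ∈ connectedComponentIn Kᶜ p) →
      ∀ᶠ n in atTop, y (a n) ∈ connectedComponentIn Kᶜ p) ∧
    ((∀ n, y (a n) ∈ connectedComponentIn Kᶜ p) →
      ∀ᶠ n in atTop, x (a n) ∈ connectedComponentIn Kᶜ p)

theorem FreudenthalEquivalent.trans_aux {X : Type*} {x y z : ℕ → X} {U : Set X}
    (hxy : ∀ a : ℕ → ℕ, StrictMono a → (∀ n, x (a n) ∈ U) → ∀ᶠ n in atTop, y (a n) ∈ U)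
    (hyz : ∀ a : ℕ → ℕ, StrictMono a → (∀ n, y (a n) ∈ U) → ∀ᶠ n in atTop, z (a n) ∈ U)
    (a : ℕ → ℕ) (ha : StrictMono a) (h : ∀ n, x (a n) ∈ U) : ∀ᶠ n in atTop, z (a n) ∈ U := by
  obtain ⟨N, hN⟩ := eventually_atTop.1 (hxy a ha h)
  have := hyz (fun n => a (n + N)) (fun m n hmn => ha (by omega)) (fun n => hN _ (by omega))
  rwa [← eventually_map (m := fun n => n + N) (P := fun n => z (a n) ∈ U),
    map_add_atTop_eq_nat] at this

/-- The simple coarse structure on `X`, based on pre-compact sets, that is given by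
Freudenthal-equivalence. -/
@[reducible] def freudenthalStructure (X : Type*) [TopologicalSpace X] [T2Space X] :
    SimpleCoarseStructure (precompactSets X) where
  r x y := FreudenthalEquivalent x.1 y.1
  iseqv :=
    { refl := fun _ _ _ _ _ _ _ =>
        ⟨fun h => Eventually.of_forall h, fun h => Eventually.of_forall h⟩
      symm := fun h a ha K hK p hp => (h a ha K hK p hp).symm
      trans := fun hxy hyz a ha K hK p hp =>
        ⟨FreudenthalEquivalent.trans_aux (fun b hb => (hxy b hb K hK p hp).1)
          (fun b hb => (hyz b hb K hK p hp).1) a ha,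
        FreudenthalEquivalent.trans_aux (fun b hb => (hyz b hb K hK p hp).2)
          (fun b hb => (hxy b hb K hK p hp).2) a ha⟩ }

/-! Existence: map `X` into the cube indexed by its continuous slowly oscillating functions and take
the closure of the image.

Zero-dimensionality: a slowly oscillating function varies little on each component of the complement
of a large compact set (`exists_compact_dist_le_of_slowlyOscillating`). Rounding it to 0 or 1 on
whole components gives a slowly oscillating function whose extension separates two given corona
points by clopen sets.

Domination: if `j : X → Y` has zero-dimensional corona, equivalent ends cannot accumulate at
different corona points, since disjoint open sets covering the corona leave only a compact part of
`X` and no component crosses from one to the other. So every continuous function on `Y` restricts to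
a slowly oscillating one and extends to the Higson compactification; these extensions determine the
map to `Y`. -/

theorem Topology.IsDenseEmbedding.isOpen_range_of_locallyCompactSpace {X H : Type*}
    [TopologicalSpace X] [TopologicalSpace H] [T2Space H] [LocallyCompactSpace X] {i : X → H} (hi : IsDenseEmbedding i) :
    IsOpen (range i) := by
  rw [isOpen_iff_mem_nhds]
  rintro _ ⟨x, rfl⟩
  obtain ⟨K, hK, hxK⟩ := exists_compact_mem_nhds x
  rw [hi.isInducing.nhds_eq_comap, mem_comap] at hxK
  obtain ⟨V, hV, hVK⟩ := hxK
  obtain ⟨U, hUV, hU, hxU⟩ := mem_nhds_iff.1 hV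
  refine mem_of_superset (hU.mem_nhds hxU) ?_
  calc U ⊆ closure (U ∩ range i) := hi.dense.open_subset_closure_inter hU
    _ ⊆ closure (i '' K) := by
        refine closure_mono ?_
        rintro _ ⟨hu, y, rfl⟩
        exact ⟨y, hVK (hUV hu), rfl⟩
    _ = i '' K := (hK.image hi.continuous).isClosed.closure_eq
    _ ⊆ range i := image_subset_range _ _

theorem SimpleEnd.eventually_notMem {X : Type*} [TopologicalSpace X] [T2Space X]
    (x : SimpleEnd (precompactSets X)) {K : Set X} (hK : IsCompact K) :
    ∀ᶠ n in atTop, x.1 n ∉ K := by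
  have h := x.2 K (show IsCompact (closure K) by rwa [hK.isClosed.closure_eq])
  rw [← Nat.cofinite_eq_atTop]
  simpa [Filter.eventually_cofinite] using h

/-! ### Components of complements of compact sets -/

/-- A component of `Kᶜ` that leaves `K'` either meets the compact frontier of `K'`, which finitely
many components cover, or avoids `K'`. In the latter case it is clopen in `X`, so it contains one of
the finitely many components of `X`. -/
theorem exists_finite_components_compl {X : Type*} [TopologicalSpace X] [T2Space X]
    [LocallyCompactSpace X] [LocallyConnectedSpace X] [Finite (ConnectedComponents X)]
    {K : Set X} (hK : IsCompact K) :
    ∃ K' : Set X, IsCompact K' ∧ K ⊆ interior K' ∧ ∃ T : Set X, T.Finite ∧ T ⊆ Kᶜ ∧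
      ∀ p ∉ K', ∃ t ∈ T, p ∈ connectedComponentIn Kᶜ t := by
  obtain ⟨K', hK', hKK'⟩ := exists_compact_superset hK
  have hfr : IsCompact (frontier K') :=
    hK'.of_isClosed_subset isClosed_frontier hK'.isClosed.frontier_subset
  have hfrK : frontier K' ⊆ Kᶜ := fun x hx hxK => hx.2 (hKK' hxK)
  have hopen : ∀ p, IsOpen (connectedComponentIn Kᶜ p) := fun p =>
    hK.isClosed.isOpen_compl.connectedComponentIn
  obtain ⟨T, hT, hcov⟩ := hfr.elim_nhds_subcover (fun p => connectedComponentIn Kᶜ p)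
    (fun p hp => (hopen p).mem_nhds (mem_connectedComponentIn (hfrK hp)))
  refine ⟨K', hK', hKK',
    (↑T ∪ range (Function.surjInv (ConnectedComponents.surjective_coe (α := X)))) ∩ Kᶜ,
    ((T.finite_toSet.union (finite_range _)).inter_of_left _), inter_subset_right, ?_⟩
  intro p hp
  have hpK : p ∈ Kᶜ := fun h => hp (interior_subset (hKK' h))
  have hpp := mem_connectedComponentIn hpK
  by_cases hne : (connectedComponentIn Kᶜ p ∩ frontier K').Nonempty
  · obtain ⟨q, hqp, hqf⟩ := hne
    obtain ⟨t, ht, hqt⟩ := mem_iUnion₂.1 (hcov hqf)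
    refine ⟨t, ⟨Or.inl ht, hfrK (hT t ht)⟩, ?_⟩
    rwa [connectedComponentIn_eq hqt, ← connectedComponentIn_eq hqp]
  · have hsub : connectedComponentIn Kᶜ p ⊆ K'ᶜ := by
      have h1 : connectedComponentIn Kᶜ p ⊆ interior K' ∪ K'ᶜ := by
        intro q hq
        by_cases hqK : q ∈ K'
        · by_contra hcon
          exact hne ⟨q, hq, subset_closure hqK, fun h => hcon (Or.inl h)⟩
        · exact Or.inr hqK
      rcases isPreconnected_connectedComponentIn.subset_or_subset isOpen_interior
        hK'.isClosed.isOpen_compl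
        (disjoint_compl_right.mono_left interior_subset) h1 with h | h
      · exact absurd (interior_subset (h hpp)) hp
      · exact h
    have hclosed : IsClosed (connectedComponentIn Kᶜ p) := by
      refine closure_subset_iff_isClosed.1 fun q hq => ?_
      have hqK : q ∈ Kᶜ := fun hqK => by
        obtain ⟨r, hr, hr'⟩ := mem_closure_iff.1 hq _ isOpen_interior (hKK' hqK)
        exact hsub hr' (interior_subset hr)
      obtain ⟨r, hr, hr'⟩ := mem_closure_iff.1 hq _ (hopen q) (mem_connectedComponentIn hqK)
      rw [connectedComponentIn_eq hr', ← connectedComponentIn_eq hr]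
      exact mem_connectedComponentIn hqK
    have hcc := IsClopen.connectedComponent_subset ⟨hclosed, hopen p⟩ hpp
    have hmem := ConnectedComponents.coe_eq_coe'.1
      (Function.surjInv_eq ConnectedComponents.surjective_coe (p : ConnectedComponents X))
    refine ⟨_, ⟨Or.inr (mem_range_self (p : ConnectedComponents X)),
      connectedComponentIn_subset _ _ (hcc hmem)⟩, ?_⟩
    rwa [← connectedComponentIn_eq (hcc hmem)]

/-- Equivalent simple ends are eventually on the same side of a separation of the complement of a
compact set into unions of components. -/
theorem FreudenthalEquivalent.eventually_mem_of_mem {X : Type*} [TopologicalSpace X] [T2Space X]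
    [LocallyCompactSpace X] [LocallyConnectedSpace X] [Finite (ConnectedComponents X)]
    {x y : SimpleEnd (precompactSets X)} (h : FreudenthalEquivalent x.1 y.1)
    {K A : Set X} (hK : IsCompact K)
    (hA : ∀ p ∈ A, connectedComponentIn Kᶜ p ⊆ A) :
    ∀ᶠ n in atTop, x.1 n ∈ A → y.1 n ∈ A := by
  obtain ⟨K', hK', -, T, hT, hTK, hcov⟩ := exists_finite_components_compl hK
  -- Equivalence handles one component at a time; finiteness of `T` makes the bound uniform.
  have key : ∀ t ∈ T, ∀ᶠ n in atTop, x.1 n ∈ connectedComponentIn Kᶜ t → x.1 n ∈ A →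
      y.1 n ∈ A := by
    intro t ht
    by_contra hcon
    rw [Filter.not_eventually] at hcon
    obtain ⟨a, ha, hP⟩ := extraction_of_frequently_atTop hcon
    push Not at hP
    obtain ⟨n, hn⟩ := ((h a ha K hK t (hTK ht)).1 fun n => (hP n).1).exists
    obtain ⟨h1, h2, h3⟩ := hP n
    rw [connectedComponentIn_eq h1] at hn
    exact h3 (hA _ h2 hn)
  filter_upwards [(eventually_all_finite hT).2 key, x.eventually_notMem hK'] with n hn hnK hnA
  obtain ⟨t, ht, hxt⟩ := hcov _ hnK
  exact hn t ht hxt hnA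

theorem FreudenthalEquivalent.eventually_mem_iff {X : Type*} [TopologicalSpace X] [T2Space X]
    [LocallyCompactSpace X] [LocallyConnectedSpace X] [Finite (ConnectedComponents X)]
    {x y : SimpleEnd (precompactSets X)} (h : FreudenthalEquivalent x.1 y.1)
    {K A : Set X} (hK : IsCompact K)
    (hA : ∀ p ∈ A, connectedComponentIn Kᶜ p ⊆ A) :
    ∀ᶠ n in atTop, x.1 n ∈ A ↔ y.1 n ∈ A := by
  have h' : FreudenthalEquivalent y.1 x.1 := (freudenthalStructure X).iseqv.symm h
  filter_upwards [h.eventually_mem_of_mem hK hA, h'.eventually_mem_of_mem hK hA] with n h1 h2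
  exact ⟨h1, h2⟩

/-- Counterexamples along a compact exhaustion would form two simple ends. They are equivalent,
because once `E n` contains `K`, a component of the complement of `E n` lies in a single component
of `Kᶜ`. -/
theorem exists_compact_dist_le_of_slowlyOscillating {X : Type*} [TopologicalSpace X] [T2Space X]
    [LocallyCompactSpace X] [SigmaCompactSpace X] {Y : Type*} [MetricSpace Y] {f : X → Y}
    (hf : (freudenthalStructure X).SlowlyOscillating f) {ε : ℝ} (hε : 0 < ε) :
    ∃ K : Set X, IsCompact K ∧ ∀ p ∈ Kᶜ, ∀ q ∈ connectedComponentIn Kᶜ p,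
      dist (f p) (f q) < ε := by
  by_contra! hcon
  let E := CompactExhaustion.choice X
  choose x hx y hy hxy using fun n => hcon (E n) (E.isCompact n)
  have hev : ∀ K : Set X, IsCompact K → ∀ᶠ n in atTop, K ⊆ E n := by
    intro K hK
    obtain ⟨n, hn⟩ := E.exists_superset_of_isCompact hK
    filter_upwards [eventually_ge_atTop n] with m hm
    exact hn.trans (E.subset hm)
  have hend : ∀ z : ℕ → X, (∀ n, z n ∈ (E n)ᶜ) →
      ∀ A, (precompactSets X).IsBounded A → {n | z n ∈ A}.Finite := by
    intro z hz A hA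
    have : ∀ᶠ n in cofinite, z n ∉ A := by
      rw [Nat.cofinite_eq_atTop]
      filter_upwards [hev _ hA] with n hn hzA
      exact hz n (hn (subset_closure hzA))
    simpa [Filter.eventually_cofinite] using this
  have heq : FreudenthalEquivalent x y := by
    intro a ha K hK p hp
    have hcomp : ∀ᶠ n in atTop, connectedComponentIn (E (a n))ᶜ (x (a n)) ⊆
        connectedComponentIn Kᶜ (x (a n)) := by
      filter_upwards [ha.tendsto_atTop.eventually (hev K hK)] with n hn
      exact connectedComponentIn_mono _ (compl_subset_compl.2 hn)
    constructor
    · intro h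
      filter_upwards [hcomp] with n hn
      rw [connectedComponentIn_eq (h n)]
      exact hn (hy _)
    · intro h
      filter_upwards [hcomp] with n hn
      rw [connectedComponentIn_eq (h n), ← connectedComponentIn_eq (hn (hy _))]
      exact mem_connectedComponentIn
        (connectedComponentIn_nonempty_iff.1 ⟨_, hn (hy _)⟩)
  have hlim := hf ⟨x, hend x hx⟩
    ⟨y, hend y fun n => connectedComponentIn_subset _ _ (hy n)⟩ heq
  obtain ⟨n, hn⟩ := (hlim.eventually (gt_mem_nhds hε)).exists
  exact absurd hn (hxy n).not_gt

/-! ### Slowly oscillating functions and the corona -/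

theorem Topology.IsDenseEmbedding.comap_nhds_neBot {X H : Type*} [TopologicalSpace X]
    [TopologicalSpace H] {i : X → H} (hi : IsDenseEmbedding i) (ξ : H) :
    (comap i (𝓝 ξ)).NeBot :=
  hi.isDenseInducing.comap_nhds_neBot ξ

theorem eventually_comap_nhds_notMem {X H : Type*} [TopologicalSpace X] [TopologicalSpace H]
    [T2Space H] {i : X → H} (hi : Continuous i) {K : Set X} (hK : IsCompact K) {ξ : H}
    (hξ : ξ ∉ range i) : ∀ᶠ x in comap i (𝓝 ξ), x ∉ K := by
  have h : (i '' K)ᶜ ∈ 𝓝 ξ :=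
    (hK.image hi).isClosed.isOpen_compl.mem_nhds fun h => hξ (image_subset_range _ _ h)
  filter_upwards [preimage_mem_comap h] with x hx hxK using hx (mem_image_of_mem i hxK)

theorem slowlyOscillating_of_eventually_eq {X Y : Type*} [TopologicalSpace X] [T2Space X]
    [MetricSpace Y] {f : X → Y}
    (h : ∀ x y : SimpleEnd (precompactSets X), FreudenthalEquivalent x.1 y.1 →
      ∀ᶠ n in atTop, f (x.1 n) = f (y.1 n)) :
    (freudenthalStructure X).SlowlyOscillating f := by
  intro x y hxy
  refine tendsto_const_nhds.congr' ?_
  filter_upwards [h x y hxy] with n hn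
  rw [hn, dist_self]

theorem slowlyOscillating_of_const_compl {X Y : Type*} [TopologicalSpace X] [T2Space X]
    [MetricSpace Y] {f : X → Y} {K : Set X} (hK : IsCompact K) {c : Y} (h : ∀ x ∉ K, f x = c) :
    (freudenthalStructure X).SlowlyOscillating f := by
  refine slowlyOscillating_of_eventually_eq fun x y _ => ?_
  filter_upwards [x.eventually_notMem hK, y.eventually_notMem hK] with n hx hy
  rw [h _ hx, h _ hy]

/-- A union of components of the complement of a compact set has, up to a bounded set, a
continuous slowly oscillating characteristic function. -/
theorem exists_slowlyOscillating_indicator {X : Type*} [TopologicalSpace X] [T2Space X]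
    [LocallyCompactSpace X] [LocallyConnectedSpace X] [Finite (ConnectedComponents X)]
    {K A : Set X} (hK : IsCompact K) (hAK : A ⊆ Kᶜ)
    (hA : ∀ p ∈ A, connectedComponentIn Kᶜ p ⊆ A) :
    ∃ K' : Set X, IsCompact K' ∧ K ⊆ K' ∧ ∃ f : X → unitInterval, Continuous f ∧
      (freudenthalStructure X).SlowlyOscillating f ∧
      ∀ x ∉ K', (x ∈ A → f x = 1) ∧ (x ∉ A → f x = 0) := by
  obtain ⟨K', hK', hKK'⟩ := exists_compact_superset hK
  obtain ⟨u, hu0, hu1, hu⟩ := exists_continuous_zero_one_of_isCompact hK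
    (isOpen_interior (s := K')).isClosed_compl (disjoint_compl_right_iff_subset.2 hKK')
  have hopen : ∀ p, IsOpen (connectedComponentIn Kᶜ p) := fun p =>
    hK.isClosed.isOpen_compl.connectedComponentIn
  have hAo : IsOpen A := isOpen_iff_mem_nhds.2 fun p hp =>
    mem_of_superset ((hopen p).mem_nhds (mem_connectedComponentIn (hAK hp))) (hA p hp)
  have hfr : frontier A ⊆ K := by
    intro p hp
    by_contra hpK
    obtain ⟨q, hq, hqA⟩ := mem_closure_iff.1 hp.1 _ (hopen p) (mem_connectedComponentIn hpK)
    have hpA : p ∈ A := by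
      apply hA q hqA
      rw [← connectedComponentIn_eq hq]
      exact mem_connectedComponentIn hpK
    exact hp.2 (hAo.interior_eq.symm ▸ hpA)
  -- The jump of the indicator is harmless: `u` vanishes on `K`, which contains the frontier of `A`.
  have hcont : Continuous (A.indicator u) :=
    continuous_indicator (fun a ha => hu0 (hfr ha)) u.continuous.continuousOn
  have hmem : ∀ x, A.indicator u x ∈ Icc (0 : ℝ) 1 := by
    intro x
    by_cases hx : x ∈ A
    · rw [indicator_of_mem hx]; exact hu x
    · rw [indicator_of_notMem hx]; simp
  have hval : ∀ x ∉ K', (x ∈ A → (⟨A.indicator u x, hmem x⟩ : unitInterval) = 1) ∧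
      (x ∉ A → (⟨A.indicator u x, hmem x⟩ : unitInterval) = 0) := by
    intro x hx
    refine ⟨fun h => Subtype.ext ?_, fun h => Subtype.ext ?_⟩
    · simpa [h] using hu1 (show x ∈ (interior K')ᶜ from fun h' => hx (interior_subset h'))
    · simp [h]
  refine ⟨K', hK', hKK'.trans interior_subset, fun x => ⟨A.indicator u x, hmem x⟩,
    hcont.subtype_mk _, slowlyOscillating_of_eventually_eq fun x y hxy => ?_, hval⟩
  filter_upwards [x.eventually_notMem hK', y.eventually_notMem hK',
    hxy.eventually_mem_iff hK hA] with n hx hy hn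
  by_cases h : x.1 n ∈ A
  · rw [(hval _ hx).1 h, (hval _ hy).1 (hn.1 h)]
  · rw [(hval _ hx).2 h, (hval _ hy).2 (fun h' => h (hn.2 h'))]

theorem compactSpace_corona {X H : Type*} [TopologicalSpace X] [LocallyCompactSpace X]
    [TopologicalSpace H] {i : X → H} (hi : IsCompactification i) : CompactSpace (Corona i) := by
  have := hi.compactSpace
  have := hi.t2Space
  exact isCompact_iff_compactSpace.1
    hi.isDenseEmbedding.isOpen_range_of_locallyCompactSpace.isClosed_compl.isCompact

/-! ### Zero-dimensionality of the Higson corona -/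

theorem IsHigsonCompactification.totallySeparatedSpace_corona {X H : Type*} [TopologicalSpace X]
    [T2Space X] [SigmaCompactSpace X] [LocallyCompactSpace X] [LocallyConnectedSpace X]
    [Finite (ConnectedComponents X)] [TopologicalSpace H] {i : X → H}
    (hi : IsHigsonCompactification (freudenthalStructure X) i) :
    TotallySeparatedSpace (Corona i) := by
  have hc := hi.isCompactification
  have := hc.compactSpace
  have := hc.t2Space
  refine ⟨fun ξ _ η _ hne => ?_⟩
  have hne' : (ξ : H) ∉ ({(η : H)} : Set H) := fun h => hne (Subtype.ext h)
  obtain ⟨g, hg, hgξ, hgη⟩ := CompletelyRegularSpace.completely_regular (ξ : H)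
    ({(η : H)} : Set H) isClosed_singleton hne'
  replace hgη : g η = 1 := hgη rfl
  obtain ⟨K, hK, hosc⟩ := exists_compact_dist_le_of_slowlyOscillating
    ((hi.extends_iff (g ∘ i)).1 ⟨g, hg, rfl⟩).2 (ε := 1 / 3) (by norm_num)
  -- The components where `g` dips below 1/3. As `g` varies by less than 1/3 on each, it stays below
  -- 2/3 on `A`, so `A` avoids points near `η`.
  let A : Set X := {p | p ∈ Kᶜ ∧ ∃ q ∈ connectedComponentIn Kᶜ p, (g (i q) : ℝ) < 1 / 3}
  obtain ⟨K', hK', hKK', f, hf, hfs, hfval⟩ := exists_slowlyOscillating_indicator (A := A) hK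
    (fun p hp => hp.1) (by
      rintro p ⟨hp, q, hq, hlt⟩ r hr
      refine ⟨connectedComponentIn_subset _ _ hr, q, ?_, hlt⟩
      rwa [← connectedComponentIn_eq hr])
  obtain ⟨G, hG, hGf⟩ := (hi.extends_iff f).2 ⟨hf, hfs⟩
  have hGi : ∀ x, G (i x) = f x := congrFun hGf
  have hmem : ∀ (c : Corona i) (s : Set unitInterval), IsClosed s →
      (∀ᶠ x in comap i (𝓝 (c : H)), x ∉ K' → f x ∈ s) → G c ∈ s := by
    intro c s hs h
    have := hc.isDenseEmbedding.comap_nhds_neBot (c : H)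
    refine hs.mem_of_tendsto ((hG.tendsto (c : H)).comp (tendsto_comap (f := i))) ?_
    filter_upwards [h, eventually_comap_nhds_notMem hc.isDenseEmbedding.continuous hK' c.2]
      with x hx hxK
    simpa [hGi] using hx hxK
  have hgt : ∀ c : H, Tendsto (fun x => (g (i x) : ℝ)) (comap i (𝓝 c)) (𝓝 (g c : ℝ)) := fun c =>
    ((continuous_subtype_val.comp hg).tendsto c).comp tendsto_comap
  have hξ : G ξ = 1 := by
    refine hmem ξ {1} isClosed_singleton ?_
    filter_upwards [(hgt ξ).eventually (gt_mem_nhds (show ((g ξ : unitInterval) : ℝ) < 1 / 3 by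
      rw [hgξ]; norm_num))] with x hx hxK
    have hxK' : x ∈ Kᶜ := fun h => hxK (hKK' h)
    exact (hfval x hxK).1 ⟨hxK', x, mem_connectedComponentIn hxK', hx⟩
  have hη : G η = 0 := by
    refine hmem η {0} isClosed_singleton ?_
    filter_upwards [(hgt η).eventually (lt_mem_nhds (show 2 / 3 < ((g η : unitInterval) : ℝ) by
      rw [hgη]; norm_num))] with x hx hxK
    refine (hfval x hxK).2 ?_
    rintro ⟨hxK', q, hq, hlt⟩
    have h := (abs_lt.1 (hosc x hxK' q hq)).2
    simp only [Function.comp_apply] at h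
    linarith
  refine ⟨{c | G c ≠ 0}, {c | G c ≠ 1},
    isOpen_ne.preimage (hG.comp continuous_subtype_val),
    isOpen_ne.preimage (hG.comp continuous_subtype_val), ?_, ?_, ?_, ?_⟩
  · simp [hξ]
  · simp [hη]
  · intro c _
    by_cases h : G c = 0
    · exact Or.inr (by simp [h])
    · exact Or.inl h
  · refine Set.disjoint_left.2 fun c h0 h1 => ?_
    -- Off `K'` the function `f` is two-valued, hence so is `G` on the corona.
    have h01 : G c ∈ ({0, 1} : Set unitInterval) := by
      refine hmem c _ (toFinite _).isClosed (Eventually.of_forall fun x hx => ?_)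
      by_cases hxA : x ∈ A
      · exact Or.inr ((hfval x hx).1 hxA)
      · exact Or.inl ((hfval x hx).2 hxA)
    exact h01.elim h0 h1

theorem IsHigsonCompactification.hasZeroDimensionalCorona {X H : Type*} [TopologicalSpace X]
    [T2Space X] [SigmaCompactSpace X] [LocallyCompactSpace X] [LocallyConnectedSpace X]
    [Finite (ConnectedComponents X)] [TopologicalSpace H] {i : X → H}
    (hi : IsHigsonCompactification (freudenthalStructure X) i) : HasZeroDimensionalCorona i := by
  have := hi.isCompactification.t2Space
  have := compactSpace_corona hi.isCompactification
  have := hi.totallySeparatedSpace_corona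
  exact hasSmallInductiveDimensionLT_one_iff.2 isTopologicalBasis_isClopen

/-- Distinct points of a zero-dimensional corona have neighbourhoods that cover the corona and are
disjoint. -/
theorem exists_isOpen_separating_corona {X Y : Type*} [TopologicalSpace X]
    [LocallyCompactSpace X] [TopologicalSpace Y] {j : X → Y} (hj : IsCompactification j)
    (hz : HasZeroDimensionalCorona j) {ξ η : Y} (hξ : ξ ∉ range j) (hη : η ∉ range j)
    (hne : ξ ≠ η) :
    ∃ V W : Set Y, IsOpen V ∧ IsOpen W ∧ Disjoint V W ∧ ξ ∈ V ∧ η ∈ W ∧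
      (range j)ᶜ ⊆ V ∪ W := by
  have := hj.compactSpace
  have := hj.t2Space
  have := compactSpace_corona hj
  obtain ⟨C, hC, hξC, hCs⟩ := (hasSmallInductiveDimensionLT_one_iff.1 hz).mem_nhds_iff.1
    ((isOpen_ne (x := (⟨η, hη⟩ : Corona j))).mem_nhds
      (show (⟨ξ, hξ⟩ : Corona j) ≠ ⟨η, hη⟩ from fun h => hne (congrArg Subtype.val h)))
  obtain ⟨V, W, hV, hW, hCV, hCW, hVW⟩ := SeparatedNhds.of_isCompact_isCompact
    (hC.isClosed.isCompact.image continuous_subtype_val)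
    (hC.compl.isClosed.isCompact.image continuous_subtype_val)
    ((disjoint_image_iff Subtype.val_injective).2 disjoint_compl_right)
  refine ⟨V, W, hV, hW, hVW, hCV ⟨_, hξC, rfl⟩, hCW ⟨⟨η, hη⟩, fun h => hCs h rfl, rfl⟩, ?_⟩
  intro c hc
  by_cases h : (⟨c, hc⟩ : Corona j) ∈ C
  · exact Or.inl (hCV ⟨_, h, rfl⟩)
  · exact Or.inr (hCW ⟨_, h, rfl⟩)

/-! ### Domination -/

theorem SimpleEnd.notMem_range_of_tendsto {X Y : Type*} [TopologicalSpace X] [T2Space X]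
    [LocallyCompactSpace X] [TopologicalSpace Y] {j : X → Y}
    (hj : IsCompactification j) (x : SimpleEnd (precompactSets X)) {l : Filter ℕ} [l.NeBot]
    (hl : l ≤ atTop) {ξ : Y} (h : Tendsto (fun n => j (x.1 n)) l (𝓝 ξ)) : ξ ∉ range j := by
  rintro ⟨p, rfl⟩
  obtain ⟨K, hK, hpK⟩ := exists_compact_mem_nhds p
  rw [← Function.comp_def, ← hj.isDenseEmbedding.isInducing.tendsto_nhds_iff] at h
  obtain ⟨n, hn, hn'⟩ := ((h.eventually hpK).and (hl (x.eventually_notMem hK))).exists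
  exact hn' hn

theorem slowlyOscillating_comp_of_hasZeroDimensionalCorona {X Y Z : Type*} [TopologicalSpace X]
    [T2Space X] [LocallyCompactSpace X] [LocallyConnectedSpace X] [Finite (ConnectedComponents X)]
    [TopologicalSpace Y] [MetricSpace Z] {j : X → Y} (hj : IsCompactification j)
    (hz : HasZeroDimensionalCorona j) {g : Y → Z} (hg : Continuous g) :
    (freudenthalStructure X).SlowlyOscillating (g ∘ j) := by
  have := hj.compactSpace
  have := hj.t2Space
  intro x y hxy
  by_contra hcon
  obtain ⟨ε, hε, hfreq⟩ : ∃ ε > 0, ∃ᶠ n in atTop,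
      ε ≤ dist ((g ∘ j) (x.1 n)) ((g ∘ j) (y.1 n)) := by
    by_contra! h
    refine hcon (tendsto_order.2 ⟨fun a ha => Eventually.of_forall fun n =>
      ha.trans_le dist_nonneg, fun a ha => ?_⟩)
    simpa using h a ha
  have : (atTop ⊓ 𝓟 {n | ε ≤ dist ((g ∘ j) (x.1 n)) ((g ∘ j) (y.1 n))}).NeBot :=
    Filter.frequently_mem_iff_neBot.1 hfreq
  -- `Y` need not be sequentially compact, so an ultrafilter on the bad indices replaces a
  -- convergent subsequence.
  let F := Ultrafilter.of (atTop ⊓ 𝓟 {n | ε ≤ dist ((g ∘ j) (x.1 n)) ((g ∘ j) (y.1 n))})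
  have hF := Ultrafilter.of_le
    (atTop ⊓ 𝓟 {n | ε ≤ dist ((g ∘ j) (x.1 n)) ((g ∘ j) (y.1 n))})
  have hFtop : (F : Filter ℕ) ≤ atTop := hF.trans inf_le_left
  have hx : Tendsto (fun n => j (x.1 n)) F (𝓝 (F.map (fun n => j (x.1 n))).lim) :=
    Ultrafilter.le_nhds_lim _
  have hy : Tendsto (fun n => j (y.1 n)) F (𝓝 (F.map (fun n => j (y.1 n))).lim) :=
    Ultrafilter.le_nhds_lim _
  generalize (F.map (fun n => j (x.1 n))).lim = ξ at hx
  generalize (F.map (fun n => j (y.1 n))).lim = η at hy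
  have hne : ξ ≠ η := by
    rintro rfl
    have hd := ((hg.tendsto _).comp hx).dist ((hg.tendsto _).comp hy)
    rw [dist_self] at hd
    have := ge_of_tendsto hd (hF (mem_inf_of_right (mem_principal_self _)))
    linarith
  obtain ⟨V, W, hV, hW, hVW, hξV, hηW, hcov⟩ := exists_isOpen_separating_corona hj hz
    (x.notMem_range_of_tendsto hj hFtop hx) (y.notMem_range_of_tendsto hj hFtop hy) hne
  have hK : IsCompact (j ⁻¹' (V ∪ W)ᶜ) := by
    rw [hj.isDenseEmbedding.isInducing.isCompact_preimage_iff]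
    · exact (hV.union hW).isClosed_compl.isCompact
    · exact compl_subset_comm.1 hcov
  have hA : ∀ p ∈ j ⁻¹' V, connectedComponentIn (j ⁻¹' (V ∪ W)ᶜ)ᶜ p ⊆ j ⁻¹' V := by
    intro p hp
    have hjc := hj.isDenseEmbedding.continuous
    have hsub : connectedComponentIn (j ⁻¹' (V ∪ W)ᶜ)ᶜ p ⊆ j ⁻¹' V ∪ j ⁻¹' W :=
      (connectedComponentIn_subset _ _).trans fun q hq => not_not.1 hq
    refine isPreconnected_connectedComponentIn.subset_left_of_subset_union (hV.preimage hjc)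
      (hW.preimage hjc) (hVW.preimage j) hsub ⟨p, mem_connectedComponentIn ?_, hp⟩
    exact fun h => h (Or.inl hp)
  obtain ⟨n, ⟨hnx, hny⟩, hn⟩ := (((hx.eventually (hV.mem_nhds hξV)).and
    (hy.eventually (hW.mem_nhds hηW))).and (hFtop (hxy.eventually_mem_of_mem hK hA))).exists
  exact Set.disjoint_left.1 hVW (hn hnx) hny

/-- A compactification dominates every compactification all of whose continuous functions it
extends. -/
theorem IsCompactification.dominates_of_forall_extends {X H Y : Type*} [TopologicalSpace X]
    [TopologicalSpace H] [TopologicalSpace Y] {i : X → H} {j : X → Y} (hi : IsCompactification i)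
    (hj : IsCompactification j)
    (h : ∀ g : Y → unitInterval, Continuous g → ∃ G : H → unitInterval, Continuous G ∧
      G ∘ i = g ∘ j) : Dominates i j := by
  have := hj.compactSpace
  have := hj.t2Space
  have hd := hi.isDenseEmbedding.isDenseInducing
  -- Each `g` takes the value `G b` at every cluster point of `j` near `b`. Such functions separate
  -- points, so by compactness the unique cluster point is a limit.
  have hlim : ∀ b, ∃ c, Tendsto j (comap i (𝓝 b)) (𝓝 c) := by
    intro b
    have := hi.isDenseEmbedding.comap_nhds_neBot b
    obtain ⟨c, hc⟩ := exists_clusterPt_of_compactSpace (map j (comap i (𝓝 b)))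
    refine ⟨c, le_nhds_of_unique_clusterPt fun d hdc => ?_⟩
    by_contra hne
    obtain ⟨g, hg, hgd, hgc⟩ := CompletelyRegularSpace.completely_regular d ({c} : Set Y)
      isClosed_singleton hne
    obtain ⟨G, hG, hGg⟩ := h g hg
    have ht : Tendsto g (map j (comap i (𝓝 b))) (𝓝 (G b)) := by
      rw [tendsto_map'_iff, ← hGg]
      exact (hG.tendsto b).comp tendsto_comap
    have huniq : ∀ e, ClusterPt e (map j (comap i (𝓝 b))) → g e = G b := fun e he =>
      eq_of_nhds_neBot (he.map hg.continuousAt ht)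
    have := (huniq d hdc).trans (huniq c hc).symm
    rw [hgd, hgc rfl] at this
    exact zero_ne_one this
  refine ⟨hd.extend j, hd.continuous_extend hlim, funext fun x => ?_⟩
  exact hd.extend_eq hj.isDenseEmbedding.continuous x

/-! ### Existence of the Higson compactification -/

theorem exists_isHigsonCompactification (X : Type u) [TopologicalSpace X] [T2Space X]
    [LocallyCompactSpace X] :
    ∃ (H : Type u) (_ : TopologicalSpace H) (i : X → H),
      IsHigsonCompactification (freudenthalStructure X) i := by
  let P := {f : X → unitInterval // Continuous f ∧ (freudenthalStructure X).SlowlyOscillating f}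
  let e : X → P → unitInterval := fun x f => f.1 x
  have hec : Continuous e := continuous_pi fun f => f.2.1
  -- Functions constant off a compact set oscillate slowly, and they already detect the topology.
  have heI : IsInducing e := by
    refine isInducing_iff_nhds.2 fun x => le_antisymm hec.continuousAt.le_comap ?_
    intro s hs
    obtain ⟨K, hKx, hKs, hK⟩ := local_compact_nhds hs
    obtain ⟨f, hfx, hfK, hf⟩ := exists_continuous_zero_one_of_isCompact
      (isCompact_singleton (x := x))
      (isOpen_interior (s := K)).isClosed_compl
      (disjoint_singleton_left.2 fun h => h (mem_interior_iff_mem_nhds.2 hKx))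
    have hval : ∀ y ∉ K, (⟨f y, hf y⟩ : unitInterval) = 1 := fun y hy =>
      Subtype.ext (hfK fun h => hy (interior_subset h))
    let F : P := ⟨fun y => ⟨f y, hf y⟩, f.continuous.subtype_mk _,
      slowlyOscillating_of_const_compl hK hval⟩
    refine ⟨{z | z F ≠ 1}, (isOpen_ne.preimage (continuous_apply F)).mem_nhds ?_, ?_⟩
    · intro h
      have h0 : f x = 0 := hfx rfl
      exact zero_ne_one (h0.symm.trans (congrArg Subtype.val h))
    · intro y hy
      by_contra hys
      exact hy (hval y fun h => hys (hKs h))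
  have hcompact : CompactSpace (closure (range e)) :=
    isCompact_iff_compactSpace.1 isClosed_closure.isCompact
  let i : X → closure (range e) := fun x => ⟨e x, subset_closure (mem_range_self x)⟩
  have hi : IsDenseEmbedding i := by
    refine ⟨⟨heI.codRestrict _, ?_⟩, ?_⟩
    · intro z
      rw [closure_subtype, ← range_comp]
      exact z.2
    · exact fun x y hxy => heI.injective (congrArg Subtype.val hxy)
  refine ⟨closure (range e), inferInstance, i, fun A => Iff.rfl,
    ⟨hcompact, inferInstance, hi⟩, fun f => ⟨?_, fun hf => ?_⟩⟩
  · rintro ⟨g, hg, rfl⟩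
    refine ⟨hg.comp hi.continuous, fun x y hxy => ?_⟩
    -- Coordinatewise slow oscillation is convergence to the product uniformity, which the uniformly
    -- continuous `g` preserves.
    have hlim : Tendsto (fun n => (i (x.1 n), i (y.1 n))) atTop
        (uniformity (closure (range e))) := by
      rw [uniformity_subtype, tendsto_comap_iff, Pi.uniformity]
      simp only [tendsto_iInf, tendsto_comap_iff]
      intro F
      exact tendsto_uniformity_iff_dist_tendsto_zero.2 (F.2.2 x y hxy)
    exact tendsto_uniformity_iff_dist_tendsto_zero.1
      (Tendsto.comp (CompactSpace.uniformContinuous_of_continuous hg) hlim)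
  · exact ⟨fun z => z.1 ⟨f, hf⟩, (continuous_apply _).comp continuous_subtype_val, rfl⟩

theorem theorem6p2 (X : Type u) [TopologicalSpace X] [T2Space X] [SigmaCompactSpace X]
    [LocallyCompactSpace X] [LocallyConnectedSpace X] [Finite (ConnectedComponents X)] :
    (∃ (H : Type u) (_ : TopologicalSpace H) (i : X → H),
      IsHigsonCompactification (freudenthalStructure X) i) ∧
    ∀ (H : Type v) [TopologicalSpace H] (i : X → H),
      IsHigsonCompactification (freudenthalStructure X) i →
        IsFreudenthalCompactification.{u, v, w} i := by
  refine ⟨exists_isHigsonCompactification X, fun H _ i hi => ?_⟩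
  refine ⟨hi.isCompactification, hi.hasZeroDimensionalCorona, fun Y _ j hj hz => ?_⟩
  refine hi.isCompactification.dominates_of_forall_extends hj fun g hg => ?_
  exact (hi.extends_iff (g ∘ j)).2 ⟨hg.comp hj.isDenseEmbedding.continuous,
    slowlyOscillating_comp_of_hasZeroDimensionalCorona hj hz hg⟩
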